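/- Let $d\in\mathbb N$, let $\mathcal X,\mathcal Y,\mathcal Z$ be arbitrary sets (of actions) and let $\mathcal B$ be a finite set (of outcomes) with $|\mathcal B|\ge 2$. A $d$-dimensional world model over $\mathcal X,\mathcal Y,\mathcal Z,\mathcal B$ is a tuple $\mathcal W=(\{\rho_x\}_{x\in\mathcal X},\{\mathcal E_y\}_{y\in\mathcal Y},\{\mathcal M_z\}_{z\in\mathcal Z})$, where each $\rho_x$ is a $d\times d$ density matrix, each $\mathcal E_y$ is a completely positive trace-preserving linear map on $d\times d$ complex matrices, and each $\mathcal M_z=\{M_{zb}\}_{b\in\mathcal B}$ is a POVM of $d\times d$ matrices. Two $d$-dimensional world models $\mathcal W_A,\mathcal W_B$ over the same spaces are weakly indistinguishable if for all $x\in\mathcal X$, $L\ge 0$, $y_1,\dots,y_L\in\mathcal Y$, $z\in\mathcal Z$ and $b\in\mathcal B$, $$\operatorname{Tr}\bigl(M^A_{zb}(\mathcal E^A_{y_L}\circ\cdots\circ\mathcal E^A_{y_1})(\rho^A_x)\bigr)=\operatorname{Tr}\bigl(M^B_{zb}(\mathcal E^B_{y_L}\circ\cdots\circ\mathcal E^B_{y_1})(\rho^B_x)\bigr).$$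 A $d$-dimensional world model $\mathcal W'$ over $\mathcal X',\mathcal Y',\mathcal Z',\mathcal B$ is an extension of $\mathcal W$ if $\mathcal X\subseteq\mathcal X'$, $\mathcal Y\subseteq\mathcal Y'$, $\mathcal Z\subseteq\mathcal Z'$ and $\rho'_x=\rho_x$, $\mathcal E'_y=\mathcal E_y$, $\mathcal M'_z=\mathcal M_z$ for all $x\in\mathcal X$, $y\in\mathcal Y$, $z\in\mathcal Z$. The models $\mathcal W_A$ and $\mathcal W_B$ are strongly indistinguishable, written $\mathcal W_A\equiv\mathcal W_B$, if for every extension $\mathcal W_A'$ of $\mathcal W_A$ there is an extension $\mathcal W_B'$ of $\mathcal W_B$ with the same action spaces $\mathcal X',\mathcal Y',\mathcal Z'$ such that $\mathcal W_A'$ and $\mathcal W_B'$ are weakly indistinguishable. A unitary transformation is a $d\times d$ unitary matrix $U$, acting on $d\times d$ matrices by $C\mapsto UCU^{-1}=UCU^\dagger$. An anti-unitary transformation is a product $U=VK$ of a $d\times d$ unitary matrix $V$ and the complex conjugation operator $K$; it acts by $C\mapsto UCU^{-1}=V\overline{C}V^\dagger$, where $\overline C$ is the entrywise conjugate of $C$.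 In both cases $C\mapsto U^{-1}CU$ denotes the inverse of $C\mapsto UCU^{-1}$. **Theorem.** Let $\mathcal W_A,\mathcal W_B$ be two $d$-dimensional world models over the same spaces $\mathcal X,\mathcal Y,\mathcal Z,\mathcal B$. Then $\mathcal W_A\equiv\mathcal W_B$ if and only if there is a single unitary or anti-unitary transformation $U$ such that $$\rho^B_x=U\rho^A_xU^{-1}\quad(x\in\mathcal X),$$ $$\mathcal E^B_y(\,\cdot\,)=U\,\mathcal E^A_y\bigl(U^{-1}(\,\cdot\,)U\bigr)\,U^{-1}\quad(y\in\mathcal Y),$$ $$M^B_{zb}=UM^A_{zb}U^{-1}\quad(z\in\mathcal Z,\ b\in\mathcal B).$$ -/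

import Mathlib

open Matrix

noncomputable section QuantumObjects

open scoped ComplexOrder MatrixOrder Matrix.Norms.L2Operator CStarAlgebra

/-- A `d`-dimensional density matrix. -/
@[ext]
structure DensityMatrix (d : ℕ) where
  mat : Matrix (Fin d) (Fin d) ℂ
  posSemidef : mat.PosSemidef
  trace_eq_one : mat.trace = 1

/-- A `d`-dimensional CPTP map: a completely positive linear map on `d × d` matrices (ordered by
positive semidefiniteness) that preserves the trace. -/
structure CPTPMap (d : ℕ) where
  map : Matrix (Fin d) (Fin d) ℂ →CP Matrix (Fin d) (Fin d) ℂ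
  trace_map : ∀ C : Matrix (Fin d) (Fin d) ℂ, (map C).trace = C.trace

instance (d : ℕ) :
    CoeFun (CPTPMap d) (fun _ => Matrix (Fin d) (Fin d) ℂ → Matrix (Fin d) (Fin d) ℂ) :=
  ⟨fun E => E.map⟩

/-- A `d`-dimensional POVM whose elements are indexed by the finite set `B` of outcomes. -/
@[ext]
structure POVM (d : ℕ) (B : Type*) [Fintype B] where
  elem : B → Matrix (Fin d) (Fin d) ℂ
  posSemidef : ∀ b, (elem b).PosSemidef
  sum_eq_one : ∑ b, elem b = 1

end QuantumObjects

/-- A `d`-dimensional world model over the action spaces `X`, `Y`, `Z` with outcome space `B`. -/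
structure WorldModel (d : ℕ) (X Y Z B : Type*) [Fintype B] where
  state : X → DensityMatrix d
  channel : Y → CPTPMap d
  povm : Z → POVM d B

namespace WorldModel

/-- The probability `Tr (M_{z b} (E_{y_L} ∘ ⋯ ∘ E_{y_1}) (ρ_x))` of the outcome `b` in the
experiment `(x, y_1, …, y_L, z)`; here `ys = [y_1, …, y_L]`. -/
noncomputable def prob {d : ℕ} {X Y Z B : Type*} [Fintype B] (W : WorldModel d X Y Z B)
    (x : X) (ys : List Y) (z : Z) (b : B) : ℂ :=
  ((W.povm z).elem b * ys.foldl (fun C y => W.channel y C) (W.state x).mat).trace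

/-- Two world models over the same spaces are weakly indistinguishable if every experiment has the
same outcome distribution in both. -/
def WeaklyIndistinguishable {d : ℕ} {X Y Z B : Type*} [Fintype B]
    (W₁ W₂ : WorldModel d X Y Z B) : Prop :=
  ∀ (x : X) (ys : List Y) (z : Z) (b : B), W₁.prob x ys z b = W₂.prob x ys z b

/-- `W'` is an extension of `W`. The inclusions `X ⊆ X'`, `Y ⊆ Y'`, `Z ⊆ Z'` of the action spaces
are given by the embeddings `i`, `j`, `k`. -/
structure IsExtension {d : ℕ} {X Y Z X' Y' Z' B : Type*} [Fintype B]
    (i : X ↪ X') (j : Y ↪ Y') (k : Z ↪ Z')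
    (W' : WorldModel d X' Y' Z' B) (W : WorldModel d X Y Z B) : Prop where
  state_eq : ∀ x, W'.state (i x) = W.state x
  channel_eq : ∀ y, W'.channel (j y) = W.channel y
  povm_eq : ∀ z, W'.povm (k z) = W.povm z

/-- `W₁` and `W₂` are strongly indistinguishable: every extension of `W₁` is weakly
indistinguishable from some extension of `W₂` with the same (larger) action spaces. -/
def StronglyIndistinguishable.{u, v, w, t} {d : ℕ} {X : Type u} {Y : Type v} {Z : Type w}
    {B : Type t} [Fintype B]
    (W₁ W₂ : WorldModel d X Y Z B) : Prop :=
  ∀ (X' : Type u) (Y' : Type v) (Z' : Type w) (i : X ↪ X') (j : Y ↪ Y') (k : Z ↪ Z')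
    (W₁' : WorldModel d X' Y' Z' B), IsExtension i j k W₁' W₁ →
      ∃ W₂' : WorldModel d X' Y' Z' B,
        IsExtension i j k W₂' W₂ ∧ WeaklyIndistinguishable W₁' W₂'

end WorldModel

/-- A unitary or anti-unitary transformation of `ℂ^d`: `unitary U` is the unitary matrix `U`, and
`antiunitary U` is the product `U K` of a unitary matrix `U` and the entrywise complex
conjugation `K`. -/
inductive UnitaryOrAntiunitary (d : ℕ) : Type
  | unitary (U : Matrix.unitaryGroup (Fin d) ℂ) : UnitaryOrAntiunitary d
  | antiunitary (U : Matrix.unitaryGroup (Fin d) ℂ) : UnitaryOrAntiunitary d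

namespace UnitaryOrAntiunitary

theorem entrywise_conj_conj {d : ℕ} (C : Matrix (Fin d) (Fin d) ℂ) :
    (C.map (starRingEnd ℂ)).map (starRingEnd ℂ) = C := by
  ext a b
  simp

theorem cancel_right {d : ℕ} (U : Matrix.unitaryGroup (Fin d) ℂ) (C : Matrix (Fin d) (Fin d) ℂ) :
    (U : Matrix (Fin d) (Fin d) ℂ)ᴴ *
      ((U : Matrix (Fin d) (Fin d) ℂ) * C * (U : Matrix (Fin d) (Fin d) ℂ)ᴴ) *
        (U : Matrix (Fin d) (Fin d) ℂ) = C := by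
  have h : (U : Matrix (Fin d) (Fin d) ℂ)ᴴ * (U : Matrix (Fin d) (Fin d) ℂ) = 1 :=
    Matrix.mem_unitaryGroup_iff'.1 U.2
  calc _ = ((U : Matrix (Fin d) (Fin d) ℂ)ᴴ * (U : Matrix (Fin d) (Fin d) ℂ)) * C *
        ((U : Matrix (Fin d) (Fin d) ℂ)ᴴ * (U : Matrix (Fin d) (Fin d) ℂ)) := by
        simp only [Matrix.mul_assoc]
    _ = C := by rw [h, Matrix.one_mul, Matrix.mul_one]

theorem cancel_left {d : ℕ} (U : Matrix.unitaryGroup (Fin d) ℂ) (C : Matrix (Fin d) (Fin d) ℂ) :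
    (U : Matrix (Fin d) (Fin d) ℂ) *
      ((U : Matrix (Fin d) (Fin d) ℂ)ᴴ * C * (U : Matrix (Fin d) (Fin d) ℂ)) *
        (U : Matrix (Fin d) (Fin d) ℂ)ᴴ = C := by
  have h : (U : Matrix (Fin d) (Fin d) ℂ) * (U : Matrix (Fin d) (Fin d) ℂ)ᴴ = 1 :=
    Matrix.mem_unitaryGroup_iff.1 U.2
  calc _ = ((U : Matrix (Fin d) (Fin d) ℂ) * (U : Matrix (Fin d) (Fin d) ℂ)ᴴ) * C *
        ((U : Matrix (Fin d) (Fin d) ℂ) * (U : Matrix (Fin d) (Fin d) ℂ)ᴴ) := by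
        simp only [Matrix.mul_assoc]
    _ = C := by rw [h, Matrix.one_mul, Matrix.mul_one]

/-- The transformation `C ↦ V C V⁻¹` of matrices: it is `C ↦ U C Uᴴ` for the unitary matrix `U`, and
`C ↦ U (conj C) Uᴴ` for the anti-unitary `U K`. Its inverse is `C ↦ V⁻¹ C V`. -/
def conjBy {d : ℕ} :
    UnitaryOrAntiunitary d → (Matrix (Fin d) (Fin d) ℂ ≃ Matrix (Fin d) (Fin d) ℂ)
  | unitary U =>
    { toFun := fun C => (U : Matrix (Fin d) (Fin d) ℂ) * C * (U : Matrix (Fin d) (Fin d) ℂ)ᴴ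
      invFun := fun C => (U : Matrix (Fin d) (Fin d) ℂ)ᴴ * C * (U : Matrix (Fin d) (Fin d) ℂ)
      left_inv := fun C => cancel_right U C
      right_inv := fun C => cancel_left U C }
  | antiunitary U =>
    { toFun := fun C => (U : Matrix (Fin d) (Fin d) ℂ) * C.map (starRingEnd ℂ) *
        (U : Matrix (Fin d) (Fin d) ℂ)ᴴ
      invFun := fun C => ((U : Matrix (Fin d) (Fin d) ℂ)ᴴ * C *
        (U : Matrix (Fin d) (Fin d) ℂ)).map (starRingEnd ℂ)
      left_inv := fun C => by
        simp only [cancel_right, entrywise_conj_conj]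
      right_inv := fun C => by
        simp only [cancel_left, entrywise_conj_conj] }

end UnitaryOrAntiunitary

/-! For the forward direction, extend `WA` by every rank-one projection `P p`, both as a state and
as an effect. The matching extension of `WB` supplies states `α p` and effects `β p` with `Tr (β p *
α q) = Tr (P p * P q)`. Inside one orthonormal basis these numbers are Kronecker deltas, and in
dimension `d` this forces `α = β`, with orthogonal projections as values
(`eq_of_forall_trace_mul_eq_ite`). So `P p ↦ β p` preserves overlaps, and Wigner's theorem
(`exists_unitaryOrAntiunitary_of_trace_mul_eq`) makes it conjugation by some `V`. Experiments of
length 0 and 1 that involve the new states and effects then determine every state, channel and POVM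
of `WB`, because the projections span all matrices.

Wigner's theorem is proved through Jordan homomorphisms: the map extends linearly, preserves squares
by the spectral theorem, is therefore multiplicative or antimultiplicative, and so is a unitary
conjugation, possibly after a transpose.

Conversely, conjugating an extension of `WA` by `V` gives an extension of `WB` with the same
probabilities. -/

theorem exists_isHermitian_add_I_smul {n : Type*} (A : Matrix n n ℂ) :
    ∃ H K : Matrix n n ℂ, H.IsHermitian ∧ K.IsHermitian ∧ A = H + Complex.I • K := by
  refine ⟨realPart A, imaginaryPart A, (realPart A).2, (imaginaryPart A).2, ?_⟩
  exact (realPart_add_I_smul_imaginaryPart A).symm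

/-! ### Rank-one projections and the trace form -/

section RankOneProjections

open scoped ComplexOrder

variable {n : Type*} [Fintype n] [DecidableEq n]

open scoped MatrixOrder Matrix.Norms.L2Operator in
theorem exists_eq_conjTranspose_mul_self {A : Matrix n n ℂ} (hA : A.PosSemidef) :
    ∃ X : Matrix n n ℂ, A = Xᴴ * X :=
  CStarAlgebra.nonneg_iff_eq_star_mul_self.1 (Matrix.nonneg_iff_posSemidef.2 hA)

/-- With `A = Xᴴ * X` and `B = Yᴴ * Y`, the trace is the squared Hilbert–Schmidt norm of `Y * Xᴴ`.
-/
theorem Matrix.PosSemidef.mul_eq_zero_of_trace_mul_eq_zero {A B : Matrix n n ℂ}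
    (hA : A.PosSemidef) (hB : B.PosSemidef) (h : (A * B).trace = 0) : A * B = 0 := by
  obtain ⟨X, rfl⟩ := exists_eq_conjTranspose_mul_self hA
  obtain ⟨Y, rfl⟩ := exists_eq_conjTranspose_mul_self hB
  have h0 : Y * Xᴴ = 0 := by
    rw [← Matrix.trace_conjTranspose_mul_self_eq_zero_iff, ← h, Matrix.conjTranspose_mul,
      Matrix.conjTranspose_conjTranspose, Matrix.mul_assoc, Matrix.trace_mul_comm X,
      Matrix.mul_assoc, Matrix.mul_assoc, ← Matrix.mul_assoc Yᴴ, Matrix.trace_mul_comm,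
      Matrix.mul_assoc]
  have h1 : X * Yᴴ = 0 := by
    simpa using congrArg Matrix.conjTranspose h0
  calc Xᴴ * X * (Yᴴ * Y) = Xᴴ * (X * Yᴴ) * Y := by simp only [Matrix.mul_assoc]
    _ = 0 := by rw [h1]; simp

/-- The rank-one projection onto the `i`-th column of the unitary matrix `U`. -/
def columnProj (p : Matrix.unitaryGroup n ℂ × n) : Matrix n n ℂ :=
  (p.1 : Matrix n n ℂ) * single p.2 p.2 1 * (p.1 : Matrix n n ℂ)ᴴ

theorem columnProj_mul (U : Matrix.unitaryGroup n ℂ) (i j : n) :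
    columnProj (U, i) * columnProj (U, j) = if i = j then columnProj (U, i) else 0 := by
  have h : (U : Matrix n n ℂ)ᴴ * (U : Matrix n n ℂ) = 1 := Matrix.mem_unitaryGroup_iff'.1 U.2
  have h2 : columnProj (U, i) * columnProj (U, j) = (U : Matrix n n ℂ) *
      (single i i 1 * ((U : Matrix n n ℂ)ᴴ * (U : Matrix n n ℂ)) * single j j 1) *
        (U : Matrix n n ℂ)ᴴ := by
    simp only [columnProj, Matrix.mul_assoc]
  rw [h2, h, Matrix.mul_one]
  split_ifs with hij
  · subst hij
    simp [columnProj]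
  · rw [Matrix.single_mul_single_of_ne _ _ _ _ hij]
    simp

theorem isHermitian_columnProj (p : Matrix.unitaryGroup n ℂ × n) :
    (columnProj p).IsHermitian := by
  simp [columnProj, Matrix.IsHermitian, Matrix.conjTranspose_mul, Matrix.mul_assoc]

theorem posSemidef_columnProj (p : Matrix.unitaryGroup n ℂ × n) :
    (columnProj p).PosSemidef := by
  have h := Matrix.posSemidef_conjTranspose_mul_self (columnProj p)
  rwa [(isHermitian_columnProj p).eq, columnProj_mul, if_pos rfl] at h

theorem posSemidef_one_sub_columnProj (p : Matrix.unitaryGroup n ℂ × n) :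
    (1 - columnProj p).PosSemidef := by
  have h := Matrix.posSemidef_conjTranspose_mul_self (1 - columnProj p)
  have h2 : columnProj p * columnProj p = columnProj p := by
    simpa using columnProj_mul p.1 p.2 p.2
  rwa [conjTranspose_sub, (isHermitian_columnProj p).eq, conjTranspose_one, Matrix.mul_sub,
    Matrix.mul_one, Matrix.sub_mul, Matrix.one_mul, h2, sub_self, sub_zero] at h

theorem trace_columnProj (p : Matrix.unitaryGroup n ℂ × n) : (columnProj p).trace = 1 := by
  have h : (p.1 : Matrix n n ℂ)ᴴ * (p.1 : Matrix n n ℂ) = 1 :=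
    Matrix.mem_unitaryGroup_iff'.1 p.1.2
  rw [columnProj, Matrix.trace_mul_comm, ← Matrix.mul_assoc, h, Matrix.one_mul,
    Matrix.trace_single_eq_same]

theorem Matrix.IsHermitian.exists_eq_sum_columnProj {A : Matrix n n ℂ} (hA : A.IsHermitian) :
    ∃ (U : Matrix.unitaryGroup n ℂ) (c : n → ℝ), A = ∑ i, (c i : ℂ) • columnProj (U, i) := by
  refine ⟨hA.eigenvectorUnitary, hA.eigenvalues, ?_⟩
  have hd : (diagonal (RCLike.ofReal ∘ hA.eigenvalues) : Matrix n n ℂ) =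
      ∑ i, (hA.eigenvalues i : ℂ) • single i i (1 : ℂ) := by
    rw [← Matrix.sum_single_eq_diagonal]
    simp
  conv_lhs => rw [hA.spectral_theorem, Unitary.conjStarAlgAut_apply, hd]
  simp only [columnProj, Matrix.mul_sum, Matrix.sum_mul, Matrix.star_eq_conjTranspose,
    Matrix.mul_smul, Matrix.smul_mul]

theorem span_range_columnProj :
    Submodule.span ℂ (Set.range (columnProj (n := n))) = ⊤ := by
  have h : ∀ A : Matrix n n ℂ, A.IsHermitian →
      A ∈ Submodule.span ℂ (Set.range (columnProj (n := n))) := by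
    intro A hA
    obtain ⟨U, c, rfl⟩ := hA.exists_eq_sum_columnProj
    exact Submodule.sum_mem _ fun i _ =>
      Submodule.smul_mem _ _ (Submodule.subset_span ⟨_, rfl⟩)
  rw [eq_top_iff]
  rintro A -
  obtain ⟨H, K, hH, hK, rfl⟩ := exists_isHermitian_add_I_smul A
  exact Submodule.add_mem _ (h H hH) (Submodule.smul_mem _ _ (h K hK))

theorem eq_of_forall_trace_columnProj_mul {A B : Matrix n n ℂ}
    (h : ∀ p, (columnProj p * A).trace = (columnProj p * B).trace) : A = B := by
  have h2 : ∀ C : Matrix n n ℂ, (C * A).trace = (C * B).trace := by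
    intro C
    have hC : C ∈ Submodule.span ℂ (Set.range (columnProj (n := n))) := by
      rw [span_range_columnProj]; trivial
    induction hC using Submodule.span_induction with
    | mem x hx => obtain ⟨p, rfl⟩ := hx; exact h p
    | zero => simp
    | add x y _ _ hx hy => simp [Matrix.add_mul, hx, hy]
    | smul a x _ hx => simp [hx]
  exact Matrix.ext_iff_trace_mul_left.2 h2

/-- Extremal probabilities 0 and 1 give `E i * ρ j = δ_ij ρ j`, so nonzero columns of the `ρ j` are
simultaneous eigenvectors of all `E i`. There are as many of them as the dimension, so they form a
basis in which `E i` is a diagonal matrix unit. Then `ρ j = E j * ρ j * E j` is a multiple of `E j`,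
and the traces agree. -/
theorem eq_of_forall_trace_mul_eq_ite {E ρ : n → Matrix n n ℂ}
    (hE : ∀ i, (E i).PosSemidef) (hE1 : ∀ i, (1 - E i).PosSemidef)
    (hρ : ∀ i, (ρ i).PosSemidef) (hρ1 : ∀ i, (ρ i).trace = 1)
    (h : ∀ i j, (E i * ρ j).trace = if i = j then 1 else 0) :
    E = ρ ∧ ∀ i j, E i * E j = if i = j then E i else 0 := by
  have hmul : ∀ i j, E i * ρ j = if i = j then ρ j else 0 := by
    intro i j
    split_ifs with hij
    · have h1 : (1 - E i) * ρ j = 0 := by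
        refine (hE1 i).mul_eq_zero_of_trace_mul_eq_zero (hρ j) ?_
        rw [Matrix.sub_mul, Matrix.trace_sub, h, if_pos hij, Matrix.one_mul, hρ1, sub_self]
      rw [Matrix.sub_mul, Matrix.one_mul, sub_eq_zero] at h1
      exact h1.symm
    · refine (hE i).mul_eq_zero_of_trace_mul_eq_zero (hρ j) ?_
      rw [h, if_neg hij]
  have hcol : ∀ j, ∃ k, ∃ i, ρ j i k ≠ 0 := by
    intro j
    by_contra! hj
    have h0 : ρ j = 0 := by ext i k; exact hj k i
    simpa [h0] using hρ1 j
  choose k a hk using hcol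
  let W : Matrix n n ℂ := Matrix.of fun i j => ρ j i (k j)
  have hEW : ∀ i, E i * W = W * single i i 1 := by
    intro i
    ext x j
    have h1 : (E i * W) x j = (E i * ρ j) x (k j) := rfl
    rw [h1, hmul]
    by_cases hij : i = j
    · subst hij; simp [W]
    · rw [if_neg hij, Matrix.mul_single_apply_of_ne _ _ _ _ _ (Ne.symm hij)]; rfl
  -- If `W *ᵥ x = 0`, applying `E i` isolates `x i` times the `i`-th column, whose entry at `a i` is
  -- nonzero.
  have hW : IsUnit W := by
    rw [← Matrix.mulVec_injective_iff_isUnit, ← Matrix.coe_mulVecLin,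
      injective_iff_map_eq_zero]
    intro x hx
    funext i
    have h1 : (W * single i i 1) *ᵥ x = 0 := by
      rw [← hEW, ← Matrix.mulVec_mulVec, ← Matrix.mulVecLin_apply W, hx, Matrix.mulVec_zero]
    rw [← Matrix.mulVec_mulVec, Matrix.single_mulVec, one_mul] at h1
    have h2 := congrFun h1 (a i)
    simpa [W, Function.update_apply, Matrix.mulVec, dotProduct, hk i] using h2
  have hWd : IsUnit W.det := (Matrix.isUnit_iff_isUnit_det W).1 hW
  have hEeq : ∀ i, E i = W * single i i 1 * W⁻¹ := by
    intro i
    rw [← hEW, Matrix.mul_nonsing_inv_cancel_right _ _ hWd]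
  have hEE : ∀ i j, E i * E j = if i = j then E i else 0 := by
    intro i j
    have h2 : E i * E j = W * (single i i 1 * (W⁻¹ * W) * single j j 1) * W⁻¹ := by
      simp only [hEeq, Matrix.mul_assoc]
    rw [h2, Matrix.nonsing_inv_mul _ hWd, Matrix.mul_one]
    split_ifs with hij
    · subst hij
      simp [hEeq]
    · rw [Matrix.single_mul_single_of_ne _ _ _ _ hij]
      simp
  refine ⟨funext fun j => ?_, hEE⟩
  have hr : ρ j * E j = ρ j := by
    have := congrArg Matrix.conjTranspose (hmul j j)
    simpa [Matrix.conjTranspose_mul, (hρ j).1.eq, (hE j).1.eq] using this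
  have h3 : ρ j = (W⁻¹ * ρ j * W) j j • E j := by
    calc ρ j = E j * ρ j * E j := by rw [hmul, if_pos rfl, hr]
      _ = W * (single j j 1 * (W⁻¹ * ρ j * W) * single j j 1) * W⁻¹ := by
        simp only [hEeq, Matrix.mul_assoc]
      _ = _ := by
        rw [Matrix.single_mul_mul_single, hEeq, ← Matrix.smul_mul, ← Matrix.mul_smul]
        simp
  have ht : (E j).trace = 1 := by
    rw [hEeq, Matrix.trace_mul_comm, Matrix.nonsing_inv_mul_cancel_left _ _ hWd,
      Matrix.trace_single_eq_same]
  have hc : (W⁻¹ * ρ j * W) j j = 1 := by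
    have := congrArg Matrix.trace h3
    rwa [hρ1, Matrix.trace_smul, ht, smul_eq_mul, mul_one, eq_comm] at this
  rw [h3, hc, one_smul]

/-- Equal Gram matrices for the nondegenerate trace form: transporting coefficients from `P` to `Q`
preserves the form, hence is injective, hence bijective by dimension. -/
theorem exists_linearEquiv_of_trace_mul_eq {ι : Type*} {P Q : ι → Matrix n n ℂ}
    (hP : Submodule.span ℂ (Set.range P) = ⊤)
    (h : ∀ i j, (Q i * Q j).trace = (P i * P j).trace) :
    ∃ φ : Matrix n n ℂ ≃ₗ[ℂ] Matrix n n ℂ, ∀ i, φ (P i) = Q i := by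
  let K := Finsupp.linearCombination ℂ P
  let L := Finsupp.linearCombination ℂ Q
  have hKL : ∀ f g, (L f * L g).trace = (K f * K g).trace := by
    intro f g
    simp only [K, L, Finsupp.linearCombination_apply, Finsupp.sum, Matrix.sum_mul, Matrix.mul_sum,
      Matrix.trace_sum, Matrix.smul_mul, Matrix.mul_smul, Matrix.trace_smul, h]
  have hK : LinearMap.range K = ⊤ := by rw [Finsupp.range_linearCombination, hP]
  obtain ⟨s, hs⟩ := K.exists_rightInverse_of_surjective hK
  have hs' : ∀ A, K (s A) = A := fun A => LinearMap.congr_fun hs A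
  have htr : ∀ A B, (L (s A) * L (s B)).trace = (A * B).trace := by
    intro A B; rw [hKL, hs', hs']
  have hinj : Function.Injective (L ∘ₗ s) := by
    rw [← LinearMap.ker_eq_bot, LinearMap.ker_eq_bot']
    intro A hA
    refine Matrix.ext_iff_trace_mul_right.2 fun B => ?_
    have hA' : L (s A) = 0 := hA
    rw [← htr, hA']
    simp
  refine ⟨LinearEquiv.ofInjectiveEndo _ hinj, fun i => ?_⟩
  refine Matrix.ext_iff_trace_mul_right.2 fun B => ?_
  -- By surjectivity it suffices to test against images, where the preserved form applies.
  obtain ⟨C, rfl⟩ := (LinearEquiv.ofInjectiveEndo _ hinj).surjective B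
  have hQ : Q i = L (Finsupp.single i 1) := by simp [L]
  have hPi : P i = K (Finsupp.single i 1) := by simp [K]
  simp only [LinearEquiv.coe_ofInjectiveEndo, LinearMap.comp_apply]
  rw [htr, hQ, hKL, hs', hPi]

end RankOneProjections

/-! ### Jordan homomorphisms and Wigner's theorem -/

section JordanHomomorphisms

variable {n : Type*} [Fintype n] [DecidableEq n]

/-- The two defects `u`, `v` satisfy `u * C * v + v * C * u = 0` for every `C`, by the Jordan triple
identities and surjectivity of `φ`. As the matrix ring is prime, one of them vanishes. -/
theorem map_mul_eq_or_map_mul_eq_swap_apply {φ : Matrix n n ℂ ≃ₗ[ℂ] Matrix n n ℂ}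
    (hφ : ∀ A, φ (A * A) = φ A * φ A) (A B : Matrix n n ℂ) :
    φ (A * B) = φ A * φ B ∨ φ (A * B) = φ B * φ A := by
  have two : ∀ {C D : Matrix n n ℂ}, C + C = D + D → C = D := by
    intro C D h
    rw [← two_smul ℂ, ← two_smul ℂ D] at h
    exact smul_right_injective _ (two_ne_zero' ℂ) h
  have h2 : ∀ A B, φ (A * B) + φ (B * A) = φ A * φ B + φ B * φ A := by
    intro A B
    have h := hφ (A + B)
    simp only [Matrix.add_mul, Matrix.mul_add, map_add, hφ] at h
    have : φ (A * B) + φ (B * A) = (φ A * φ A + φ (B * A) + (φ (A * B) + φ B * φ B)) -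
      φ A * φ A - φ B * φ B := by abel
    rw [this, h]
    abel
  have h3 : ∀ A B, φ (A * B * A) = φ A * φ B * φ A := by
    intro A B
    apply two
    have e := h2 A (A * B + B * A)
    have e2 := h2 (A * A) B
    rw [map_add φ (A * B), h2 A B] at e
    rw [hφ] at e2
    have e3 : φ (A * B * A) + φ (A * B * A) =
        φ (A * (A * B + B * A)) + φ ((A * B + B * A) * A) - (φ (A * A * B) + φ (B * (A * A))) := by
      rw [← map_add, ← map_add, ← map_add, ← map_sub]
      congr 1
      noncomm_ring
    rw [e3, e, e2]
    noncomm_ring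
  have h4 : ∀ A B C, φ (A * B * C + C * B * A) = φ A * φ B * φ C + φ C * φ B * φ A := by
    intro A B C
    have e : A * B * C + C * B * A = (A + C) * B * (A + C) - A * B * A - C * B * C := by
      noncomm_ring
    rw [e, map_sub, map_sub, h3, h3, h3, map_add]
    noncomm_ring
  have key : ∀ C, (φ (A * B) - φ A * φ B) * C * (φ (A * B) - φ B * φ A) +
      (φ (A * B) - φ B * φ A) * C * (φ (A * B) - φ A * φ B) = 0 := by
    intro C
    obtain ⟨C, rfl⟩ := φ.surjective C
    have e1 := h4 (A * B) C (B * A)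
    -- One element is expanded in two ways: as a triple product with outer factors `A * B`, `B * A`,
    -- and as nested products `A (B C B) A`.
    have e2 : A * B * C * (B * A) + B * A * C * (A * B) =
        A * (B * C * B) * A + B * (A * C * A) * B := by noncomm_ring
    rw [e2, map_add, h3, h3, h3, h3] at e1
    have e3 : φ (B * A) = φ A * φ B + φ B * φ A - φ (A * B) := by rw [← h2]; abel
    rw [e3] at e1
    have e4 := sub_eq_zero.2 e1
    rw [← e4]
    noncomm_ring
  by_contra! hne
  have hu := sub_ne_zero.2 hne.1
  have hv := sub_ne_zero.2 hne.2
  set u := φ (A * B) - φ A * φ B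
  set v := φ (A * B) - φ B * φ A
  have huv : ∀ i j k l, u i j * v k l + v i j * u k l = 0 := by
    intro i j k l
    have := congrFun (congrFun (key (single j k 1)) i) l
    simpa [Matrix.mul_apply, Matrix.single_apply, ite_and, Finset.sum_ite_eq] using this
  obtain ⟨i, j, hij⟩ : ∃ i j, u i j ≠ 0 := by
    by_contra! h; exact hu (Matrix.ext h)
  obtain ⟨k, l, hkl⟩ : ∃ i j, v i j ≠ 0 := by
    by_contra! h; exact hv (Matrix.ext h)
  have h5 : v i j = 0 := by
    have := huv i j i j
    have h6 : 2 * (u i j * v i j) = 0 := by linear_combination this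
    simpa [hij] using h6
  have := huv i j k l
  simp [h5, hij, hkl] at this

/-- A group is not the union of two proper subgroups. -/
theorem forall_or_forall_of_add_closed {G : Type*} [AddGroup G] {p q : G → Prop}
    (hp : ∀ a b, p a → p b → p (a + b)) (hp' : ∀ a, p a → p (-a))
    (hq : ∀ a b, q a → q b → q (a + b)) (hq' : ∀ a, q a → q (-a))
    (h : ∀ a, p a ∨ q a) : (∀ a, p a) ∨ ∀ a, q a := by
  by_contra! hc
  obtain ⟨⟨a, ha⟩, b, hb⟩ := hc
  have ha' : q a := (h a).resolve_left ha
  have hb' : p b := (h b).resolve_right hb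
  rcases h (a + b) with hab | hab
  · apply ha
    simpa using hp _ _ hab (hp' _ hb')
  · apply hb
    simpa using hq _ _ (hq' _ ha') hab

/-- The subgroup argument makes the choice uniform first in `B` for fixed `A`, then in `A`. -/
theorem map_mul_or_map_mul_swap {φ : Matrix n n ℂ ≃ₗ[ℂ] Matrix n n ℂ}
    (hφ : ∀ A, φ (A * A) = φ A * φ A) :
    (∀ A B, φ (A * B) = φ A * φ B) ∨ ∀ A B, φ (A * B) = φ B * φ A := by
  refine forall_or_forall_of_add_closed (p := fun A => ∀ B, φ (A * B) = φ A * φ B)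
    (q := fun A => ∀ B, φ (A * B) = φ B * φ A) ?_ ?_ ?_ ?_ fun A =>
    forall_or_forall_of_add_closed ?_ ?_ ?_ ?_ (map_mul_eq_or_map_mul_eq_swap_apply hφ A)
  all_goals
    intros
    simp only [Matrix.add_mul, Matrix.mul_add, Matrix.neg_mul, Matrix.mul_neg, map_add,
      map_neg, *]

/-- A multiplicative, star-preserving linear bijection of matrices is conjugation by a unitary. -/
theorem exists_unitary_conj {φ : Matrix n n ℂ ≃ₗ[ℂ] Matrix n n ℂ}
    (hmul : ∀ A B, φ (A * B) = φ A * φ B) (hstar : ∀ A, φ Aᴴ = (φ A)ᴴ) :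
    ∃ U : Matrix.unitaryGroup n ℂ, ∀ A, φ A = (U : Matrix n n ℂ) * A * (U : Matrix n n ℂ)ᴴ := by
  let Φ : Matrix n n ℂ ≃⋆ₐ[ℂ] Matrix n n ℂ :=
    { φ with
      map_mul' := hmul
      map_star' := hstar }
  -- On operators of Euclidean space, continuous star-automorphisms are known to be unitary
  -- conjugations.
  let τ := Matrix.toEuclideanCLM (𝕜 := ℂ) (n := n)
  let f := τ.symm.trans (Φ.trans τ)
  have hf : Continuous f :=
    LinearMap.continuous_of_finiteDimensional f.toAlgEquiv.toLinearMap
  obtain ⟨U, hU⟩ := f.eq_linearIsometryEquivConjStarAlgEquiv hf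
  rw [← Unitary.conjStarAlgAut_symm_unitaryLinearIsometryEquiv] at hU
  set u := Unitary.linearIsometryEquiv.symm U
  refine ⟨⟨τ.symm u, Unitary.map_mem τ.symm u.2⟩, fun A => ?_⟩
  have h : τ (φ A) = u * τ A * star (u : EuclideanSpace ℂ n →L[ℂ] EuclideanSpace ℂ n) := by
    have := congrArg (fun g => g (τ A)) hU
    simpa [f, Φ] using this
  have h2 := congrArg τ.symm h
  rw [StarAlgEquiv.symm_apply_apply, map_mul, map_mul, StarAlgEquiv.symm_apply_apply] at h2
  rw [h2, ← Matrix.star_eq_conjTranspose]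
  congr 1
  exact τ.symm.map_star' _

variable {Q : Matrix.unitaryGroup n ℂ × n → Matrix n n ℂ}

/-- A Hermitian matrix is a combination of projections from a single basis, whose orthogonality `Q`
respects. Polarizing at `H + K` then handles `H + i K`. -/
theorem map_mul_self_of_map_columnProj {φ : Matrix n n ℂ ≃ₗ[ℂ] Matrix n n ℂ}
    (hQ : ∀ U i j, Q (U, i) * Q (U, j) = if i = j then Q (U, i) else 0)
    (hφ : ∀ p, φ (columnProj p) = Q p) (A : Matrix n n ℂ) : φ (A * A) = φ A * φ A := by
  have hH : ∀ A : Matrix n n ℂ, A.IsHermitian → φ (A * A) = φ A * φ A := by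
    intro A hA
    obtain ⟨U, c, rfl⟩ := hA.exists_eq_sum_columnProj
    simp only [Matrix.sum_mul, Matrix.mul_sum, Matrix.smul_mul, Matrix.mul_smul, columnProj_mul,
      map_sum, map_smul, hφ, hQ, apply_ite φ, map_zero]
  obtain ⟨H, K, hH1, hK1, rfl⟩ := exists_isHermitian_add_I_smul A
  have e := hH (H + K) (hH1.add hK1)
  have e1 := hH H hH1
  have e2 := hH K hK1
  simp only [Matrix.add_mul, Matrix.mul_add, map_add, e1, e2] at e
  simp only [Matrix.add_mul, Matrix.mul_add, Matrix.smul_mul, Matrix.mul_smul, map_add, map_smul,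
    e1, e2]
  have e3 : φ (K * H) + φ (H * K) = φ K * φ H + φ H * φ K := by
    have : φ (K * H) + φ (H * K) = φ H * φ H + φ (K * H) + (φ (H * K) + φ K * φ K) -
      φ H * φ H - φ K * φ K := by abel
    rw [this, e]
    abel
  have e4 := congrArg (fun X => Complex.I • X) e3
  simp only [smul_add] at e4
  simp only [smul_add]
  calc _ = φ H * φ H + Complex.I • Complex.I • (φ K * φ K) +
        (Complex.I • φ (K * H) + Complex.I • φ (H * K)) := by abel
    _ = _ := by rw [e4]; abel

theorem map_conjTranspose_of_map_columnProj {φ : Matrix n n ℂ ≃ₗ[ℂ] Matrix n n ℂ}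
    (hQ : ∀ p, (Q p).IsHermitian) (hφ : ∀ p, φ (columnProj p) = Q p) (A : Matrix n n ℂ) :
    φ Aᴴ = (φ A)ᴴ := by
  have hH : ∀ A : Matrix n n ℂ, A.IsHermitian → (φ A)ᴴ = φ A := by
    intro A hA
    obtain ⟨U, c, rfl⟩ := hA.exists_eq_sum_columnProj
    simp only [map_sum, map_smul, hφ, Matrix.conjTranspose_sum, Matrix.conjTranspose_smul,
      (hQ _).eq, RCLike.star_def, Complex.conj_ofReal]
  obtain ⟨H, K, hH1, hK1, rfl⟩ := exists_isHermitian_add_I_smul A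
  simp only [Matrix.conjTranspose_add, Matrix.conjTranspose_smul, map_add, map_smul, hH1.eq,
    hK1.eq, hH H hH1, hH K hK1]

end JordanHomomorphisms

/-- Wigner's theorem. The conclusion stays on projections because the linear extension `φ` and an
antilinear `V.conjBy` can agree only on Hermitian matrices, where transpose equals entrywise
conjugate. -/
theorem exists_unitaryOrAntiunitary_of_trace_mul_eq {d : ℕ}
    {Q : Matrix.unitaryGroup (Fin d) ℂ × Fin d → Matrix (Fin d) (Fin d) ℂ}
    (hQH : ∀ p, (Q p).IsHermitian)
    (hQ : ∀ U i j, Q (U, i) * Q (U, j) = if i = j then Q (U, i) else 0)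
    (htr : ∀ p q, (Q p * Q q).trace = (columnProj p * columnProj q).trace) :
    ∃ V : UnitaryOrAntiunitary d, ∀ p, V.conjBy (columnProj p) = Q p := by
  obtain ⟨φ, hφ⟩ := exists_linearEquiv_of_trace_mul_eq span_range_columnProj htr
  have hstar := map_conjTranspose_of_map_columnProj hQH hφ
  rcases map_mul_or_map_mul_swap (map_mul_self_of_map_columnProj hQ hφ) with h | h
  · obtain ⟨U, hU⟩ := exists_unitary_conj h hstar
    refine ⟨.unitary U, fun p => ?_⟩
    rw [← hφ, hU]
    rfl
  · obtain ⟨U, hU⟩ := exists_unitary_conj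
      (φ := (Matrix.transposeLinearEquiv (Fin d) (Fin d) ℂ ℂ).trans φ)
      (fun A B => by simp [Matrix.transpose_mul, h])
      (fun A => by
        change φ Aᴴᵀ = (φ Aᵀ)ᴴ
        rw [← hstar]
        rfl)
    refine ⟨.antiunitary U, fun p => ?_⟩
    have hp : (columnProj p).map (starRingEnd ℂ) = (columnProj p)ᵀ := by
      conv_rhs => rw [← (isHermitian_columnProj p).eq]
      rfl
    have h1 : φ (columnProj p) = U * (columnProj p)ᵀ * (U : Matrix (Fin d) (Fin d) ℂ)ᴴ :=
      hU (columnProj p)ᵀ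
    rw [← hφ, h1, ← hp]
    rfl

/-! ### Algebra of unitary and anti-unitary conjugation -/

namespace UnitaryOrAntiunitary

variable {d : ℕ} (V : UnitaryOrAntiunitary d)

/-- The action on scalars: trivial for a unitary, complex conjugation for an anti-unitary. -/
def scalar : UnitaryOrAntiunitary d → (ℂ →+* ℂ)
  | unitary _ => RingHom.id ℂ
  | antiunitary _ => starRingEnd ℂ

theorem scalar_scalar (c : ℂ) : V.scalar (V.scalar c) = c := by
  cases V <;> simp [scalar]

theorem scalar_eq_self {c : ℂ} (hc : starRingEnd ℂ c = c) : V.scalar c = c := by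
  cases V <;> simp [scalar, hc]

theorem conjBy_add (A C : Matrix (Fin d) (Fin d) ℂ) :
    V.conjBy (A + C) = V.conjBy A + V.conjBy C := by
  cases V <;> simp [conjBy, Matrix.mul_add, Matrix.add_mul, Matrix.map_add]

theorem conjBy_mul (A C : Matrix (Fin d) (Fin d) ℂ) :
    V.conjBy (A * C) = V.conjBy A * V.conjBy C := by
  have key (U : Matrix.unitaryGroup (Fin d) ℂ) (A C : Matrix (Fin d) (Fin d) ℂ) :
      (U : Matrix (Fin d) (Fin d) ℂ) * (A * C) * (U : Matrix (Fin d) (Fin d) ℂ)ᴴ =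
        (U : Matrix (Fin d) (Fin d) ℂ) * A * (U : Matrix (Fin d) (Fin d) ℂ)ᴴ *
          ((U : Matrix (Fin d) (Fin d) ℂ) * C * (U : Matrix (Fin d) (Fin d) ℂ)ᴴ) := by
    have h : (U : Matrix (Fin d) (Fin d) ℂ)ᴴ * (U : Matrix (Fin d) (Fin d) ℂ) = 1 :=
      Matrix.mem_unitaryGroup_iff'.1 U.2
    calc _ = (U : Matrix (Fin d) (Fin d) ℂ) * A *
          ((U : Matrix (Fin d) (Fin d) ℂ)ᴴ * (U : Matrix (Fin d) (Fin d) ℂ)) * C *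
            (U : Matrix (Fin d) (Fin d) ℂ)ᴴ := by
          rw [h, Matrix.mul_one]; simp only [Matrix.mul_assoc]
      _ = _ := by simp only [Matrix.mul_assoc]
  cases V with
  | unitary U => exact key U A C
  | antiunitary U =>
    change _ * (A * C).map (starRingEnd ℂ) * _ = _
    rw [Matrix.map_mul]
    exact key U _ _

theorem conjBy_smul (c : ℂ) (A : Matrix (Fin d) (Fin d) ℂ) :
    V.conjBy (c • A) = V.scalar c • V.conjBy A := by
  cases V with
  | unitary U => simp [conjBy, scalar]
  | antiunitary U =>
    have h : (c • A).map (starRingEnd ℂ) = starRingEnd ℂ c • A.map (starRingEnd ℂ) := by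
      ext i j; simp
    simp [conjBy, scalar, h]

theorem conjBy_conjTranspose (A : Matrix (Fin d) (Fin d) ℂ) :
    V.conjBy Aᴴ = (V.conjBy A)ᴴ := by
  cases V with
  | unitary U => simp [conjBy, Matrix.conjTranspose_mul, Matrix.mul_assoc]
  | antiunitary U =>
    have h : Aᴴ.map (starRingEnd ℂ) = (A.map (starRingEnd ℂ))ᴴ := by
      ext i j; simp
    simp [conjBy, Matrix.conjTranspose_mul, Matrix.mul_assoc, h]

theorem trace_conjBy (A : Matrix (Fin d) (Fin d) ℂ) :
    (V.conjBy A).trace = V.scalar A.trace := by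
  have key (U : Matrix.unitaryGroup (Fin d) ℂ) (A : Matrix (Fin d) (Fin d) ℂ) :
      ((U : Matrix (Fin d) (Fin d) ℂ) * A * (U : Matrix (Fin d) (Fin d) ℂ)ᴴ).trace = A.trace := by
    have h : (U : Matrix (Fin d) (Fin d) ℂ)ᴴ * (U : Matrix (Fin d) (Fin d) ℂ) = 1 :=
      Matrix.mem_unitaryGroup_iff'.1 U.2
    rw [Matrix.trace_mul_comm, ← Matrix.mul_assoc, h, Matrix.one_mul]
  cases V with
  | unitary U => exact key U A
  | antiunitary U =>
    refine (key U _).trans ?_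
    simp [Matrix.trace, scalar]

/-- `C ↦ V C V⁻¹` as a ring automorphism. -/
def conjRingEquiv : Matrix (Fin d) (Fin d) ℂ ≃+* Matrix (Fin d) (Fin d) ℂ :=
  { V.conjBy with
    map_mul' := V.conjBy_mul
    map_add' := V.conjBy_add }

theorem conjBy_symm_smul (c : ℂ) (A : Matrix (Fin d) (Fin d) ℂ) :
    V.conjBy.symm (c • A) = V.scalar c • V.conjBy.symm A := by
  apply V.conjBy.injective
  rw [conjBy_smul, scalar_scalar, Equiv.apply_symm_apply, Equiv.apply_symm_apply]

theorem conjBy_symm_conjTranspose (A : Matrix (Fin d) (Fin d) ℂ) :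
    V.conjBy.symm Aᴴ = (V.conjBy.symm A)ᴴ := by
  apply V.conjBy.injective
  rw [conjBy_conjTranspose, Equiv.apply_symm_apply, Equiv.apply_symm_apply]

theorem trace_conjBy_symm (A : Matrix (Fin d) (Fin d) ℂ) :
    (V.conjBy.symm A).trace = V.scalar A.trace := by
  rw [← V.scalar_scalar (V.conjBy.symm A).trace, ← trace_conjBy, Equiv.apply_symm_apply]

/-- The trace of a product of Hermitian matrices is real, so a possible complex conjugation is
invisible. -/
theorem trace_conjBy_mul_conjBy {A C : Matrix (Fin d) (Fin d) ℂ} (hA : A.IsHermitian)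
    (hC : C.IsHermitian) : (V.conjBy A * V.conjBy C).trace = (A * C).trace := by
  rw [← conjBy_mul, trace_conjBy]
  apply scalar_eq_self
  rw [starRingEnd_apply, ← Matrix.trace_conjTranspose, Matrix.conjTranspose_mul, hA.eq, hC.eq,
    Matrix.trace_mul_comm]

/-- Tomography: overlaps with the transformed projections identify a matrix. -/
theorem eq_conjBy_of_forall_trace {A H : Matrix (Fin d) (Fin d) ℂ} (hH : H.IsHermitian)
    (h : ∀ p, (V.conjBy (columnProj p) * H).trace = (columnProj p * A).trace) :
    H = V.conjBy A := by
  rw [← Equiv.symm_apply_eq]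
  refine eq_of_forall_trace_columnProj_mul fun p => ?_
  have hH' : (V.conjBy.symm H).IsHermitian := by
    rw [Matrix.IsHermitian, ← conjBy_symm_conjTranspose, hH.eq]
  rw [← V.trace_conjBy_mul_conjBy (isHermitian_columnProj p) hH', Equiv.apply_symm_apply, h]

end UnitaryOrAntiunitary

/-! ### Transporting states, channels and POVMs -/

noncomputable section Transport

open scoped ComplexOrder MatrixOrder Matrix.Norms.L2Operator CStarAlgebra

/-- Nonnegative elements are generated by the `star N * N`, a form kept by any star-preserving ring
map applied entrywise. No linearity is asked, so anti-unitary conjugation is covered; this gives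
complete positivity of conjugated channels. -/
theorem CStarMatrix.map_nonneg_of_starRingEquiv {A : Type*} [CStarAlgebra A] [PartialOrder A]
    [StarOrderedRing A] (f : A ≃+* A) (hf : ∀ a, f (star a) = star (f a)) {k : ℕ}
    {M : CStarMatrix (Fin k) (Fin k) A} (hM : 0 ≤ M) : 0 ≤ M.map f := by
  rw [StarOrderedRing.nonneg_iff] at hM ⊢
  induction hM using AddSubmonoid.closure_induction with
  | mem M hM =>
    obtain ⟨N, rfl⟩ := hM
    refine AddSubmonoid.subset_closure ⟨N.map f, ?_⟩
    ext i j
    simp [CStarMatrix.map_apply, CStarMatrix.mul_apply, CStarMatrix.star_apply, hf]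
  | zero =>
    have h : (0 : CStarMatrix (Fin k) (Fin k) A).map f = 0 := by ext; simp
    rw [h]
    exact zero_mem _
  | add M N _ _ hM hN =>
    have h : (M + N).map f = M.map f + N.map f := by ext; simp
    rw [h]
    exact add_mem hM hN

variable {d : ℕ}

theorem UnitaryOrAntiunitary.posSemidef_conjBy (V : UnitaryOrAntiunitary d)
    {A : Matrix (Fin d) (Fin d) ℂ} (hA : A.PosSemidef) : (V.conjBy A).PosSemidef := by
  obtain ⟨X, rfl⟩ := exists_eq_conjTranspose_mul_self hA
  rw [V.conjBy_mul, V.conjBy_conjTranspose]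
  exact Matrix.posSemidef_conjTranspose_mul_self _

namespace CPTPMap

@[ext]
theorem ext {E F : CPTPMap d} (h : ∀ C, E C = F C) : E = F := by
  obtain ⟨E, _⟩ := E
  obtain ⟨F, _⟩ := F
  obtain rfl : E = F := DFunLike.ext _ _ h
  rfl

theorem posSemidef_apply (E : CPTPMap d) {A : Matrix (Fin d) (Fin d) ℂ} (hA : A.PosSemidef) :
    (E A).PosSemidef :=
  Matrix.nonneg_iff_posSemidef.1 (map_nonneg E.map (Matrix.nonneg_iff_posSemidef.2 hA))

/-- The channel `C ↦ V E(V⁻¹ C V) V⁻¹`. -/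
def conj (V : UnitaryOrAntiunitary d) (E : CPTPMap d) : CPTPMap d where
  map :=
    { toFun := fun C => V.conjBy (E (V.conjBy.symm C))
      map_add' := fun A C => by
        have h : V.conjBy.symm (A + C) = V.conjBy.symm A + V.conjBy.symm C :=
          V.conjRingEquiv.symm.map_add A C
        rw [h, map_add, V.conjBy_add]
      map_smul' := fun c A => by
        rw [V.conjBy_symm_smul, map_smul, V.conjBy_smul, V.scalar_scalar, RingHom.id_apply]
      map_cstarMatrix_nonneg' := fun k M hM =>
        CStarMatrix.map_nonneg_of_starRingEquiv V.conjRingEquiv V.conjBy_conjTranspose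
          (E.map.map_cstarMatrix_nonneg' k _
            (CStarMatrix.map_nonneg_of_starRingEquiv V.conjRingEquiv.symm
              V.conjBy_symm_conjTranspose hM)) }
  trace_map := fun C => by
    change (V.conjBy (E (V.conjBy.symm C))).trace = _
    rw [V.trace_conjBy, E.trace_map, V.trace_conjBy_symm, V.scalar_scalar]

end CPTPMap

/-- The state `V ρ V⁻¹`. -/
def DensityMatrix.conj (V : UnitaryOrAntiunitary d) (ρ : DensityMatrix d) : DensityMatrix d where
  mat := V.conjBy ρ.mat
  posSemidef := V.posSemidef_conjBy ρ.posSemidef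
  trace_eq_one := by rw [V.trace_conjBy, ρ.trace_eq_one, map_one]

/-- The POVM with elements `V M V⁻¹`. -/
def POVM.conj {B : Type*} [Fintype B] (V : UnitaryOrAntiunitary d) (M : POVM d B) : POVM d B where
  elem b := V.conjBy (M.elem b)
  posSemidef b := V.posSemidef_conjBy (M.posSemidef b)
  sum_eq_one := by
    change ∑ b, V.conjRingEquiv (M.elem b) = 1
    rw [← map_sum, M.sum_eq_one, map_one]

theorem POVM.posSemidef_one_sub {B : Type*} [Fintype B] (M : POVM d B) (b : B) :
    (1 - M.elem b).PosSemidef := by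
  classical
  rw [← M.sum_eq_one, ← Finset.add_sum_erase _ _ (Finset.mem_univ b), add_sub_cancel_left]
  exact Matrix.posSemidef_sum _ fun i _ => M.posSemidef i

open Classical in
/-- The POVM which tests the effect `A` with the outcome `b₀` and its complement with `b₁`. -/
def POVM.ofEffect {B : Type*} [Fintype B] (b₀ b₁ : B) (A : Matrix (Fin d) (Fin d) ℂ)
    (hA : A.PosSemidef) (hA' : (1 - A).PosSemidef) : POVM d B where
  -- The sum form is a POVM even if `b₀ = b₁`; distinctness matters only for reading off `A`.
  elem b := (Pi.single b₀ A : B → _) b + (Pi.single b₁ (1 - A) : B → _) b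
  posSemidef b := by
    refine Matrix.PosSemidef.add ?_ ?_
    · by_cases h : b = b₀
      · subst h; simpa using hA
      · simpa [h] using Matrix.PosSemidef.zero
    · by_cases h : b = b₁
      · subst h; simpa using hA'
      · simpa [h] using Matrix.PosSemidef.zero
  sum_eq_one := by
    simp [Finset.sum_add_distrib]

theorem POVM.ofEffect_elem {B : Type*} [Fintype B] {b₀ b₁ : B} (hb : b₀ ≠ b₁)
    (A : Matrix (Fin d) (Fin d) ℂ) (hA : A.PosSemidef) (hA' : (1 - A).PosSemidef) :
    (POVM.ofEffect b₀ b₁ A hA hA').elem b₀ = A := by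
  simp [POVM.ofEffect, hb]

/-! ### Strong indistinguishability of world models -/

namespace WorldModel

variable {X Y Z B : Type*} [Fintype B]

/-- The world model transformed by `V`. -/
def conj (V : UnitaryOrAntiunitary d) (W : WorldModel d X Y Z B) : WorldModel d X Y Z B where
  state x := (W.state x).conj V
  channel y := (W.channel y).conj V
  povm z := (W.povm z).conj V

theorem posSemidef_foldl (W : WorldModel d X Y Z B) (ys : List Y)
    {A : Matrix (Fin d) (Fin d) ℂ} (hA : A.PosSemidef) :
    (ys.foldl (fun C y => W.channel y C) A).PosSemidef := by
  induction ys generalizing A with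
  | nil => exact hA
  | cons y ys ih => exact ih ((W.channel y).posSemidef_apply hA)

theorem foldl_conj (V : UnitaryOrAntiunitary d) (W : WorldModel d X Y Z B) (ys : List Y)
    (A : Matrix (Fin d) (Fin d) ℂ) :
    ys.foldl (fun C y => (W.conj V).channel y C) (V.conjBy A) =
      V.conjBy (ys.foldl (fun C y => W.channel y C) A) := by
  induction ys generalizing A with
  | nil => rfl
  | cons y ys ih =>
    rw [List.foldl_cons, List.foldl_cons, ← ih]
    congr 1
    change V.conjBy (W.channel y (V.conjBy.symm (V.conjBy A))) = _
    rw [Equiv.symm_apply_apply]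

theorem weaklyIndistinguishable_conj (V : UnitaryOrAntiunitary d) (W : WorldModel d X Y Z B) :
    W.WeaklyIndistinguishable (W.conj V) := by
  intro x ys z b
  have h := foldl_conj V W ys (W.state x).mat
  rw [prob, prob]
  change _ = (V.conjBy ((W.povm z).elem b) *
    ys.foldl (fun C y => (W.conj V).channel y C) (V.conjBy (W.state x).mat)).trace
  rw [h, V.trace_conjBy_mul_conjBy ((W.povm z).posSemidef b).1
    (W.posSemidef_foldl ys (W.state x).posSemidef).1]

theorem exists_conjBy_of_stronglyIndistinguishable (hB : 2 ≤ Fintype.card B)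
    {WA WB : WorldModel d X Y Z B} (h : WA.StronglyIndistinguishable WB) :
    ∃ V : UnitaryOrAntiunitary d,
      (∀ x : X, (WB.state x).mat = V.conjBy (WA.state x).mat) ∧
      (∀ (y : Y) (C : Matrix (Fin d) (Fin d) ℂ),
        WB.channel y C = V.conjBy (WA.channel y (V.conjBy.symm C))) ∧
      (∀ (z : Z) (b : B), (WB.povm z).elem b = V.conjBy ((WA.povm z).elem b)) := by
  obtain ⟨b₀, b₁, hb⟩ := Fintype.exists_pair_of_one_lt_card hB
  -- No new channels are needed. `ULift` keeps the larger action spaces in the universes of `X` and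
  -- `Z`.
  let WA' : WorldModel d (X ⊕ ULift (Matrix.unitaryGroup (Fin d) ℂ × Fin d)) Y
      (Z ⊕ ULift (Matrix.unitaryGroup (Fin d) ℂ × Fin d)) B :=
    { state := Sum.elim WA.state fun p =>
        ⟨columnProj p.down, posSemidef_columnProj _, trace_columnProj _⟩
      channel := WA.channel
      povm := Sum.elim WA.povm fun p =>
        POVM.ofEffect b₀ b₁ (columnProj p.down) (posSemidef_columnProj _)
          (posSemidef_one_sub_columnProj _) }
  obtain ⟨WB', ⟨hs, hc, hm⟩, hw⟩ := h _ _ _ Function.Embedding.inl (Function.Embedding.refl Y)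
    Function.Embedding.inl WA' ⟨fun _ => rfl, fun _ => rfl, fun _ => rfl⟩
  have hA : ∀ p, ((WA'.povm (Sum.inr ⟨p⟩)).elem b₀) = columnProj p := fun p =>
    POVM.ofEffect_elem hb _ (posSemidef_columnProj p) (posSemidef_one_sub_columnProj p)
  have hs' : ∀ x, WB'.state (Sum.inl x) = WB.state x := hs
  have hc' : ∀ y, WB'.channel y = WB.channel y := hc
  have hm' : ∀ z, WB'.povm (Sum.inl z) = WB.povm z := hm
  let α : Matrix.unitaryGroup (Fin d) ℂ × Fin d → Matrix (Fin d) (Fin d) ℂ :=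
    fun p => (WB'.state (Sum.inr ⟨p⟩)).mat
  let β : Matrix.unitaryGroup (Fin d) ℂ × Fin d → Matrix (Fin d) (Fin d) ℂ :=
    fun p => (WB'.povm (Sum.inr ⟨p⟩)).elem b₀
  have htr : ∀ p q, (β p * α q).trace = (columnProj p * columnProj q).trace := by
    intro p q
    have := hw (Sum.inr ⟨q⟩) [] (Sum.inr ⟨p⟩) b₀
    rw [prob, prob, hA] at this
    exact this.symm
  have hdual : ∀ U, (fun i => β (U, i)) = (fun i => α (U, i)) ∧
      ∀ i j, β (U, i) * β (U, j) = if i = j then β (U, i) else 0 := fun U =>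
    eq_of_forall_trace_mul_eq_ite (fun i => POVM.posSemidef _ _)
      (fun i => POVM.posSemidef_one_sub _ _) (fun i => DensityMatrix.posSemidef _)
      (fun i => DensityMatrix.trace_eq_one _) fun i j => by
        rw [htr, columnProj_mul]
        split_ifs
        · exact trace_columnProj _
        · simp
  have hαβ : ∀ p, α p = β p := fun p => (congrFun (hdual p.1).1 p.2).symm
  obtain ⟨V, hV⟩ := exists_unitaryOrAntiunitary_of_trace_mul_eq (Q := β)
    (fun p => ((WB'.povm _).posSemidef _).1) (fun U => (hdual U).2)
    fun p q => by rw [← htr, hαβ]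
  refine ⟨V, fun x => ?_, fun y => ?_, fun z b => ?_⟩
  · refine V.eq_conjBy_of_forall_trace (WB.state x).posSemidef.1 fun p => ?_
    have := hw (Sum.inl x) [] (Sum.inr ⟨p⟩) b₀
    rw [prob, prob, hA, hs'] at this
    rw [hV]
    exact this.symm
  -- Both sides are additive and twist scalars by `V.scalar` alike, so projections suffice; there a
  -- length-one experiment between new state and new effect decides.
  · have hE : ∀ C, WB.channel y (V.conjBy C) = V.conjBy (WA.channel y C) := by
      intro C
      have hC : C ∈ Submodule.span ℂ (Set.range (columnProj (n := Fin d))) := by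
        rw [span_range_columnProj]; trivial
      induction hC using Submodule.span_induction with
      | mem C hC =>
        obtain ⟨q, rfl⟩ := hC
        refine V.eq_conjBy_of_forall_trace ((WB.channel y).posSemidef_apply
          (V.posSemidef_conjBy (posSemidef_columnProj q))).1 fun p => ?_
        have := hw (Sum.inr ⟨q⟩) [y] (Sum.inr ⟨p⟩) b₀
        rw [prob, prob, hA, List.foldl_cons, List.foldl_cons, hc'] at this
        rw [hV, hV, ← hαβ q]
        exact this.symm
      | zero =>
        have h0 : V.conjBy 0 = 0 := V.conjRingEquiv.map_zero
        rw [h0, map_zero, map_zero, h0]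
      | add A C _ _ hA hC => rw [V.conjBy_add, map_add, map_add, V.conjBy_add, hA, hC]
      | smul c A _ hA => rw [V.conjBy_smul, map_smul, map_smul, V.conjBy_smul, hA]
    intro C
    rw [← hE, Equiv.apply_symm_apply]
  · refine V.eq_conjBy_of_forall_trace ((WB.povm z).posSemidef b).1 fun p => ?_
    have := hw (Sum.inr ⟨p⟩) [] (Sum.inl z) b
    rw [prob, prob, hm'] at this
    rw [hV, ← hαβ p, Matrix.trace_mul_comm, Matrix.trace_mul_comm (columnProj p)]
    exact this.symm

end WorldModel

end Transport

theorem theoremA1 {d : ℕ} {X Y Z B : Type*} [Fintype B] (hB : 2 ≤ Fintype.card B)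
    (WA WB : WorldModel d X Y Z B) :
    WA.StronglyIndistinguishable WB ↔
      ∃ V : UnitaryOrAntiunitary d,
        (∀ x : X, (WB.state x).mat = V.conjBy (WA.state x).mat) ∧
        (∀ (y : Y) (C : Matrix (Fin d) (Fin d) ℂ),
          WB.channel y C = V.conjBy (WA.channel y (V.conjBy.symm C))) ∧
        (∀ (z : Z) (b : B), (WB.povm z).elem b = V.conjBy ((WA.povm z).elem b)) := by
  refine ⟨WorldModel.exists_conjBy_of_stronglyIndistinguishable hB, ?_⟩
  rintro ⟨V, hs, hc, hm⟩ X' Y' Z' i j k WA' ⟨hs', hc', hm'⟩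
  refine ⟨WA'.conj V, ⟨fun x => ?_, fun y => ?_, fun z => ?_⟩,
    WorldModel.weaklyIndistinguishable_conj V WA'⟩
  · refine DensityMatrix.ext ?_
    rw [hs, ← hs']
    rfl
  · refine CPTPMap.ext fun C => ?_
    rw [hc, ← hc']
    rfl
  · refine POVM.ext (funext fun b => ?_)
    rw [hm, ← hm']
    rfl
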